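/- A one-sided labeling scheme with $s$-bit labels for a finite simple graph $G$ consists of a probability distribution over labelings $\ell\colon V(G)\to\{0,1\}^s$ and a deterministic decoder $\mathcal D\colon\{0,1\}^s\times\{0,1\}^s\to\{0,1\}$ such that, for every labeling $\ell$ of positive probability and every edge $(u,v)\in E(G)$, $\mathcal D(\ell(u),\ell(v))=1$ (the scheme only errs on non-edges). An adaptive adversary, who knows $G$ and the scheme, plays the following game against a random labeling $\ell$: it asks one after the other for the labels of vertices $x_1,\dots,x_k$, each choice depending on the answers so far ($k$ is not fixed in advance), and then declares two distinct vertices $x_{k+1},x_{k+2}$ that it has not asked. It forges if the decoding is wrong on them, i.e. $\mathcal D(\ell(x_{k+1}),\ell(x_{k+2}))\neq \mathbb 1_{(x_{k+1},x_{k+2})\in E(G)}$. **Theorem.** Let $\alpha\in(0,1)$. There is a constant $K\in\mathbb N$, depending only on $\alpha$, such that the following holds for all natural numbers $d$ and $s$ with $s<\frac{\alpha^4 d}{34560}$. Let $G$ be any finite simple graph that contains at least $K^{2^s}$ vertices of degree at least $d$ at pairwise distance at least $3$ (vertices in different components being at infinite distance). Then for every one-sided labeling scheme for $G$ with $s$-bit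 labels there is an adaptive adversary that forges with probability at least $1-\alpha$. (In particular, for every $\alpha$ and $d$ there is an $n$ such that this holds for every graph with $n$ vertices of degree at least $d$ at pairwise distance at least $3$ and all $s<\frac{\alpha^4 d}{34560}$ simultaneously.) -/

import Mathlib

/-- Labels of size `s`: bit strings of length `s`. -/
abbrev BitLabel (s : ℕ) : Type := Fin s → Bool

/-- A randomized adjacency labeling of a graph with vertex set `V` by `s`-bit labels: the encoder
outputs a labeling function drawn from a probability distribution, and the decoder is a
deterministic function of two labels. A scheme for a family of graphs gives one of these for every
graph of the family. -/
structure AdjacencySketch (V : Type*) (s : ℕ) where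
  encoder : PMF (V → BitLabel s)
  decode : BitLabel s → BitLabel s → Bool

/-- The decoder answers wrongly on the ordered pair `(x, y)` under the labeling `l` of `G`:
its answer differs from the indicator of `x` and `y` being adjacent. -/
def AdjacencySketch.Errs {V : Type*} {s : ℕ} (S : AdjacencySketch V s) (G : SimpleGraph V)
    (l : V → BitLabel s) (x y : V) : Prop :=
  ¬ (S.decode (l x) (l y) = true ↔ G.Adj x y)

/-- The sketch only errs on non-edges: for every labeling that the encoder can output, no edge of
`G` is decoded wrongly. -/
def AdjacencySketch.OneSided {V : Type*} {s : ℕ} (S : AdjacencySketch V s)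
    (G : SimpleGraph V) : Prop :=
  ∀ l ∈ S.encoder.support, ∀ x y : V, G.Adj x y → ¬ S.Errs G l x y

/-- A (deterministic) adaptive adversary, as a decision tree: it either stops and declares an
ordered pair of candidates, or asks for the label of a vertex and continues depending on the
answer. The number of queries need not be fixed in advance. -/
inductive Adversary (V L : Type*) where
  | declare (x y : V) : Adversary V L
  | query (x : V) (next : L → Adversary V L) : Adversary V L

/-- The adversary obeys the rules of the game when the labels of the vertices in `Q` have already
been asked: every query is new, and the two candidates are distinct vertices that have not been
asked. (With `n` vertices, at most `n - 2` queries are thus possible.) -/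
def Adversary.IsLegalFrom {V L : Type*} : Adversary V L → Set V → Prop
  | .declare x y, Q => x ≠ y ∧ x ∉ Q ∧ y ∉ Q
  | .query x next, Q => x ∉ Q ∧ ∀ a : L, (next a).IsLegalFrom (insert x Q)

/-- The adversary obeys the rules of the game, which starts with no vertex asked. -/
def Adversary.IsLegal {V L : Type*} (A : Adversary V L) : Prop :=
  A.IsLegalFrom ∅

/-- The candidates declared by the adversary when the vertices are labeled by `l`. -/
def Adversary.candidates {V L : Type*} : Adversary V L → (V → L) → V × V
  | .declare x y, _ => (x, y)
  | .query x next, l => (next (l x)).candidates l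

/-- The probability, over the labeling output by the encoder, that the candidates declared by the
adversary are decoded wrongly. -/
noncomputable def AdjacencySketch.forgeryProb {V : Type*} {s : ℕ} (S : AdjacencySketch V s)
    (G : SimpleGraph V) (A : Adversary V (BitLabel s)) : ℝ :=
  (S.encoder.toOuterMeasure
    {l | S.Errs G l (A.candidates l).1 (A.candidates l).2}).toReal

/-! Fix `d` neighbours of each center; the `i`-th ones form layer `i`. The adversary reads all
layers before some layer `i`, then declares a center `x` and the `i`-th neighbour of another center
`y`. This is a non-edge, so it forges when the decoder accepts.

Given the answers so far, the profile of a center is the probability, for each label `a`, that `a`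
rejects its next neighbour. By pigeonhole on rounded profiles, at least half of the centers `x` have
a partner `y` whose profile exceeds theirs nowhere by more than ε = 1/m.

For fixed `a`, multiply over the layers: 1 or 0 as `a` accepts or rejects the neighbour of `x`,
times 2 if `a` rejects that of the partner. Each factor has conditional mean at most 1 + ε, so the
product has mean at most (1 + ε)^d. Summing over all 2^s labels covers the unknown label of `x`,
which accepts all its own neighbours by one-sidedness. Jensen bounds the expected number of rejected
partner neighbours by s + dε / log 2 (`sum_sum_rejected_partner_le`). Averaging over layers and
centers gives rejection probability at most 2(s/d + ε / log 2) ≤ α (`exists_layer_and_rule`). -/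

/-! ### Adversaries that read a fixed list of vertices -/

/-- The adversary that asks for the labels of all vertices of a list, recording the answers in a
labeling, and then declares the pair that `f` assigns to the record. -/
def Adversary.queryAll {V L : Type*} [DecidableEq V] :
    List V → ((V → L) → V × V) → (V → L) → Adversary V L
  | [], f, acc => .declare (f acc).1 (f acc).2
  | x :: xs, f, acc => .query x fun a => queryAll xs f (Function.update acc x a)

theorem Adversary.candidates_queryAll {V L : Type*} [DecidableEq V] (xs : List V)
    (f : (V → L) → V × V) (acc l : V → L) :
    (queryAll xs f acc).candidates l = f (fun v => if v ∈ xs then l v else acc v) := by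
  induction xs generalizing acc with
  | nil => simp [queryAll, candidates]
  | cons x xs ih =>
    simp only [queryAll, candidates, ih]
    congr 1
    funext v
    by_cases h1 : v ∈ xs
    · simp [h1]
    · by_cases h2 : v = x
      · subst h2; simp [h1]
      · simp [h1, h2]

/-- Legality concerns every branch of the decision tree, so the conditions on `f` range over all
records `h`. -/
theorem Adversary.isLegalFrom_queryAll {V L : Type*} [DecidableEq V] (xs : List V)
    (f : (V → L) → V × V) (acc : V → L) (Q : Set V) (hxs : xs.Nodup) (hQ : ∀ x ∈ xs, x ∉ Q)
    (hne : ∀ h, (f h).1 ≠ (f h).2) (h₁ : ∀ h, (f h).1 ∉ Q ∧ (f h).1 ∉ xs)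
    (h₂ : ∀ h, (f h).2 ∉ Q ∧ (f h).2 ∉ xs) :
    (queryAll xs f acc).IsLegalFrom Q := by
  induction xs generalizing acc Q with
  | nil => exact ⟨hne _, (h₁ _).1, (h₂ _).1⟩
  | cons x xs ih =>
    rw [List.nodup_cons] at hxs
    refine ⟨hQ x (by simp), fun a => ih _ _ hxs.2 ?_ ?_ ?_⟩
    · intro y hy
      simp only [Set.mem_insert_iff, not_or]
      exact ⟨fun h => hxs.1 (h ▸ hy), hQ y (by simp [hy])⟩
    · intro h
      have := h₁ h
      simp only [List.mem_cons, not_or, Set.mem_insert_iff] at this ⊢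
      tauto
    · intro h
      have := h₂ h
      simp only [List.mem_cons, not_or, Set.mem_insert_iff] at this ⊢
      tauto

/-! ### Probabilistic, pigeonhole and averaging tools -/

/-- If each factor `g i` is determined by the information `H j` for `j > i`, and its conditional
expectation given `H i` is at most `c`, then the product of `n` factors has expectation at most
`c ^ n`. -/
theorem sum_mul_prod_le_pow_of_fiber_le {Ω β : Type*} [Fintype Ω] [Fintype β] [DecidableEq β]
    (w : Ω → ℝ) (g : ℕ → Ω → ℝ) (H : ℕ → Ω → β) (c : ℝ) (hc : 0 ≤ c)
    (hg : ∀ i ω, 0 ≤ g i ω) (hdep : ∀ i j ω ω', i < j → H j ω = H j ω' → g i ω = g i ω')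
    (hle : ∀ i b, ∑ ω with H i ω = b, w ω * g i ω ≤ c * ∑ ω with H i ω = b, w ω) (n : ℕ) :
    ∑ ω, w ω * ∏ i ∈ Finset.range n, g i ω ≤ c ^ n * ∑ ω, w ω := by
  induction n with
  | zero => simp
  | succ n ih =>
    have step : ∑ ω, w ω * ∏ i ∈ Finset.range (n + 1), g i ω
        ≤ c * ∑ ω, w ω * ∏ i ∈ Finset.range n, g i ω := by
      rw [← Finset.sum_fiberwise (s := Finset.univ) (g := H n),
        ← Finset.sum_fiberwise (s := Finset.univ) (g := H n)
          (f := fun ω => w ω * ∏ i ∈ Finset.range n, g i ω), Finset.mul_sum]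
      refine Finset.sum_le_sum fun b _ => ?_
      by_cases hb : ∃ ω₀, H n ω₀ = b
      · obtain ⟨ω₀, hω₀⟩ := hb
        have hprod : ∀ ω ∈ Finset.univ.filter (fun ω => H n ω = b),
            ∏ i ∈ Finset.range n, g i ω = ∏ i ∈ Finset.range n, g i ω₀ := fun ω hω =>
          Finset.prod_congr rfl fun i hi => hdep i n _ _ (Finset.mem_range.1 hi)
            ((Finset.mem_filter.1 hω).2.trans hω₀.symm)
        have e1 : ∑ ω with H n ω = b, w ω * ∏ i ∈ Finset.range (n + 1), g i ω
            = (∏ i ∈ Finset.range n, g i ω₀) * ∑ ω with H n ω = b, w ω * g n ω := by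
          rw [Finset.mul_sum]
          refine Finset.sum_congr rfl fun ω hω => ?_
          rw [Finset.prod_range_succ, hprod ω hω]; ring
        have e2 : ∑ ω with H n ω = b, w ω * ∏ i ∈ Finset.range n, g i ω
            = (∏ i ∈ Finset.range n, g i ω₀) * ∑ ω with H n ω = b, w ω := by
          rw [Finset.mul_sum]
          refine Finset.sum_congr rfl fun ω hω => ?_
          rw [hprod ω hω]; ring
        rw [e1, e2]
        have := mul_le_mul_of_nonneg_left (hle n b)
          (Finset.prod_nonneg fun i (_ : i ∈ Finset.range n) => hg i ω₀)
        linarith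
      · have : Finset.univ.filter (fun ω => H n ω = b) = ∅ :=
          Finset.filter_eq_empty_iff.2 fun ω _ h => hb ⟨ω, h⟩
        simp [this]
    calc _ ≤ _ := step
      _ ≤ c * (c ^ n * ∑ ω, w ω) := mul_le_mul_of_nonneg_left ih hc
      _ = _ := by ring

/-- Jensen's inequality for the exponential function. -/
theorem sum_mul_le_of_sum_mul_exp_le {Ω : Type*} [Fintype Ω] (w : Ω → ℝ) (hw : ∀ ω, 0 ≤ w ω)
    (hw1 : ∑ ω, w ω = 1) (F : Ω → ℝ) (B : ℝ)
    (hB : ∑ ω, w ω * Real.exp (F ω) ≤ Real.exp B) : ∑ ω, w ω * F ω ≤ B := by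
  have := convexOn_exp.map_sum_le (t := Finset.univ) (w := w) (p := F) (fun ω _ => hw ω) hw1
    (fun _ _ => Set.mem_univ _)
  simp only [smul_eq_mul] at this
  exact Real.exp_le_exp.1 (this.trans hB)

/-- Among at least `2 (m + 1) ^ |A|` functions `A → [0, p]`, at least half have another one
that exceeds them nowhere by more than `p / m`. -/
theorem card_le_two_mul_card_filter_exists_le_add {V A : Type*} [Fintype A] [DecidableEq V]
    (C : Finset V) (m : ℕ) (hm : 0 < m) (q : V → A → ℝ) (p : ℝ)
    (h0 : ∀ x a, 0 ≤ q x a) (h1 : ∀ x a, q x a ≤ p)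
    (hC : 2 * (m + 1) ^ Fintype.card A ≤ C.card)
    [DecidablePred fun x => ∃ y ∈ C, y ≠ x ∧ ∀ a, q y a ≤ q x a + p / m] :
    C.card ≤ 2 * (C.filter fun x => ∃ y ∈ C, y ≠ x ∧ ∀ a, q y a ≤ q x a + p / m).card := by
  classical
  have hm' : (0 : ℝ) < m := by exact_mod_cast hm
  set P : V → Prop := fun x => ∃ y ∈ C, y ≠ x ∧ ∀ a, q y a ≤ q x a + p / m with hP
  have hfl : ∀ x a, ⌊m * (q x a / p)⌋₊ < m + 1 := by
    intro x a
    rw [Nat.lt_succ_iff]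
    refine Nat.floor_le_of_le ?_
    have : q x a / p ≤ 1 := div_le_one_of_le₀ (h1 x a) ((h0 x a).trans (h1 x a))
    nlinarith
  -- Values are rounded down to multiples of `p / m`. Equal roundings make two elements partners, so
  -- `φ` is injective on those without one.
  let φ : V → A → Fin (m + 1) := fun x a => ⟨⌊m * (q x a / p)⌋₊, hfl x a⟩
  have hinj : Set.InjOn φ (C.filter fun x => ¬ P x) := by
    intro x hx y hy hxy
    by_contra hne
    simp only [Finset.coe_filter, Set.mem_ofPred_eq] at hx hy
    refine hx.2 ⟨y, hy.1, fun h => hne h.symm, fun a => ?_⟩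
    have hfa : ⌊m * (q x a / p)⌋₊ = ⌊m * (q y a / p)⌋₊ := congrArg Fin.val (congrFun hxy a)
    have hp : 0 ≤ p := (h0 x a).trans (h1 x a)
    rcases hp.eq_or_lt with hp0 | hp0
    · have e1 := h1 y a
      have e2 := h0 x a
      rw [← hp0] at e1 ⊢
      simp only [zero_div]; linarith
    · have l1 : (⌊m * (q x a / p)⌋₊ : ℝ) ≤ m * (q x a / p) :=
        Nat.floor_le (mul_nonneg hm'.le (div_nonneg (h0 x a) hp))
      have l2 := Nat.lt_floor_add_one (m * (q y a / p))
      rw [← hfa] at l2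
      have l3 : m * (q y a / p) < m * (q x a / p) + 1 := by linarith
      have e : ∀ z, z = (p / m) * (m * (z / p)) := fun z => by field_simp
      have hpm : 0 < p / m := div_pos hp0 hm'
      have := mul_le_mul_of_nonneg_left l3.le hpm.le
      rw [mul_add, ← e, ← e] at this
      linarith
  have hcard : (C.filter fun x => ¬ P x).card ≤ (m + 1) ^ Fintype.card A := by
    have := Finset.card_le_card_of_injOn φ (t := Finset.univ) (fun _ _ => by simp) hinj
    simpa using this
  have hsum : (C.filter P).card + (C.filter fun x => ¬ P x).card = C.card :=
    Finset.card_filter_add_card_filter_not _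
  have : C.card ≤ 2 * (C.filter P).card := by omega
  convert this

/-- Averaging: if every `T h` holds at least half of `C`, then the best choice from `T h`, made
with knowledge of `h = H l`, costs at most twice the average cost over `C`. -/
theorem exists_choice_sum_le {Ω β V : Type*} [Fintype Ω] [Fintype β] [DecidableEq β]
    (R : V → Ω → ℝ) (hR : ∀ x l, 0 ≤ R x l) (H : Ω → β) (C : Finset V) (hC : C.Nonempty)
    (T : β → Finset V) (hT : ∀ h, T h ⊆ C) (hhalf : ∀ h, C.card ≤ 2 * (T h).card) (B : ℝ)
    (hB : ∑ x ∈ C, ∑ l, R x l ≤ C.card * B) :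
    ∃ X : β → V, (∀ h, X h ∈ T h) ∧ ∑ l, R (X (H l)) l ≤ 2 * B := by
  have hCpos : 0 < C.card := Finset.card_pos.2 hC
  have hCR : (0 : ℝ) < C.card := by exact_mod_cast hCpos
  -- The cheapest element on the fibre costs at most the average over `T h`, hence at most twice the
  -- average over `C`.
  have hbest : ∀ h, ∃ x ∈ T h, ∀ x' ∈ T h,
      ∑ l with H l = h, R x l ≤ ∑ l with H l = h, R x' l := fun h =>
    Finset.exists_min_image _ _ (Finset.card_pos.1 (by have := hhalf h; omega))
  choose X hXmem hXmin using hbest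
  have hfib : ∀ h, C.card * ∑ l with H l = h, R (X h) l ≤
      2 * ∑ x ∈ C, ∑ l with H l = h, R x l := by
    intro h
    have hnn : ∀ x, 0 ≤ ∑ l with H l = h, R x l := fun x => Finset.sum_nonneg fun l _ => hR x l
    have h1 := Finset.card_nsmul_le_sum (T h) _ _ (hXmin h)
    have h2 := Finset.sum_le_sum_of_subset_of_nonneg (hT h) (fun x _ _ => hnn x)
    have h3 : (C.card : ℝ) ≤ 2 * (T h).card := by exact_mod_cast hhalf h
    rw [nsmul_eq_mul] at h1
    have h4 := mul_le_mul_of_nonneg_right h3 (hnn (X h))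
    linarith
  have htot : C.card * ∑ l, R (X (H l)) l ≤ C.card * (2 * B) := by
    calc _ = ∑ h, C.card * ∑ l with H l = h, R (X h) l := by
          rw [← Finset.sum_fiberwise Finset.univ H fun l => R (X (H l)) l, Finset.mul_sum]
          refine Finset.sum_congr rfl fun h _ => ?_
          congr 1
          refine Finset.sum_congr rfl fun l hl => ?_
          rw [(Finset.mem_filter.1 hl).2]
      _ ≤ ∑ h, 2 * ∑ x ∈ C, ∑ l with H l = h, R x l := Finset.sum_le_sum fun h _ => hfib h
      _ = 2 * ∑ x ∈ C, ∑ l, R x l := by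
          rw [← Finset.mul_sum, Finset.sum_comm]
          congr 1
          exact Finset.sum_congr rfl fun x _ => Finset.sum_fiberwise Finset.univ H _
      _ ≤ _ := by linarith
  exact ⟨X, hXmem, le_of_mul_le_mul_left htot hCR⟩

/-! ### Layers and histories -/

/-- The labeling that agrees with `l` on `Q` and is constant elsewhere. -/
def maskLabel {V L : Type*} [DecidableEq V] [Inhabited L] (Q : Finset V) (l : V → L) : V → L :=
  fun v => if v ∈ Q then l v else default

theorem maskLabel_eq_iff {V L : Type*} [DecidableEq V] [Inhabited L] (Q : Finset V)
    (l l' : V → L) : maskLabel Q l = maskLabel Q l' ↔ ∀ v ∈ Q, l v = l' v := by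
  constructor
  · intro h v hv
    simpa [maskLabel, hv] using congrFun h v
  · intro h
    funext v
    by_cases hv : v ∈ Q
    · simp [maskLabel, hv, h v hv]
    · simp [maskLabel, hv]

/-- The first `i` listed neighbours of all centers. -/
def firstLayers {V : Type*} [DecidableEq V] (C : Finset V) (v : V → ℕ → V) (i : ℕ) : Finset V :=
  (C ×ˢ Finset.range i).image fun z => v z.1 z.2

theorem mem_firstLayers {V : Type*} [DecidableEq V] {C : Finset V} {v : V → ℕ → V} {i : ℕ}
    {u : V} : u ∈ firstLayers C v i ↔ ∃ x ∈ C, ∃ j < i, v x j = u := by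
  simp only [firstLayers, Finset.mem_image, Finset.mem_product, Finset.mem_range, Prod.exists]
  constructor
  · rintro ⟨x, j, ⟨hx, hj⟩, h⟩; exact ⟨x, hx, j, hj, h⟩
  · rintro ⟨x, hx, j, hj, h⟩; exact ⟨x, j, ⟨hx, hj⟩, h⟩

theorem firstLayers_mono {V : Type*} [DecidableEq V] (C : Finset V) (v : V → ℕ → V) {i j : ℕ}
    (h : i ≤ j) : firstLayers C v i ⊆ firstLayers C v j := by
  intro u hu
  obtain ⟨x, hx, k, hk, e⟩ := mem_firstLayers.1 hu
  exact mem_firstLayers.2 ⟨x, hx, k, hk.trans_le h, e⟩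

/-! ### Partners and the exponential moment bound -/

section Partner

variable {V L : Type*} [Fintype V] [DecidableEq V] [Fintype L] [DecidableEq L] [Inhabited L]

/-- For a center `x` whose `i`-th neighbour is always accepted, let `π i h` be a center whose
`i`-th neighbour is, given that the first `i` layers have labels `h`, rejected by no label with
much larger probability than that of `x` (or `none`). Then `x` rejects on average only few of the
`i`-th neighbours of `π i h`. -/
theorem sum_sum_rejected_partner_le (D : L → L → Bool) (w : (V → L) → ℝ) (hw : ∀ l, 0 ≤ w l)
    (hw1 : ∑ l, w l = 1) (C : Finset V) (v : V → ℕ → V) (d : ℕ) (x : V) (hx : x ∈ C)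
    (hacc : ∀ l, w l ≠ 0 → ∀ i < d, D (l x) (l (v x i)) = true)
    (ε : ℝ) (hε : 0 ≤ ε) (π : ℕ → (V → L) → Option V)
    (hπ : ∀ i h y, π i h = some y → y ∈ C ∧ ∀ a,
      ∑ l with maskLabel (firstLayers C v i) l = h, w l * (if D a (l (v y i)) then 0 else 1) ≤
      ∑ l with maskLabel (firstLayers C v i) l = h, w l * (if D a (l (v x i)) then 0 else 1) +
      ε * ∑ l with maskLabel (firstLayers C v i) l = h, w l) :
    ∑ i ∈ Finset.range d, ∑ l, w l *
      ((π i (maskLabel (firstLayers C v i) l)).elim 0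
        fun y => if D (l x) (l (v y i)) then 0 else 1) ≤
      (Real.log (Fintype.card L) + d * ε) / Real.log 2 := by
  set H : ℕ → (V → L) → (V → L) := fun i => maskLabel (firstLayers C v i) with hH
  have hlog2 : 0 < Real.log 2 := Real.log_pos (by norm_num)
  let F : L → ℕ → (V → L) → ℝ := fun a i l =>
    (π i (H i l)).elim 0 fun y => if D a (l (v y i)) then 0 else 1
  let g : L → ℕ → (V → L) → ℝ := fun a i l =>
    (π i (H i l)).elim 1 fun y =>
      (if D a (l (v x i)) then 1 else 0) * (if D a (l (v y i)) then 1 else 2)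
  have hg : ∀ a i l, 0 ≤ g a i l := by
    intro a i l
    simp only [g]
    cases π i (H i l) with
    | none => simp
    | some y => simp only [Option.elim]; positivity
  have hdep : ∀ a i j l l', i < j → H j l = H j l' → g a i l = g a i l' := by
    intro a i j l l' hij hl
    have hl' := (maskLabel_eq_iff _ _ _).1 hl
    have hHi : H i l = H i l' :=
      (maskLabel_eq_iff _ _ _).2 fun u hu => hl' u (firstLayers_mono C v hij.le hu)
    have hlay : ∀ y ∈ C, l (v y i) = l' (v y i) := fun y hy =>
      hl' _ (mem_firstLayers.2 ⟨y, hy, i, hij, rfl⟩)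
    simp only [g, hHi]
    cases hp : π i (H i l') with
    | none => rfl
    | some y =>
      have hy := (hπ i _ y hp).1
      simp only [Option.elim, hlay x hx, hlay y hy]
  have hle : ∀ a i h, ∑ l with H i l = h, w l * g a i l ≤
      (1 + ε) * ∑ l with H i l = h, w l := by
    intro a i h
    have hs : 0 ≤ ∑ l with H i l = h, w l := Finset.sum_nonneg fun l _ => hw l
    have hcongr : ∑ l with H i l = h, w l * g a i l = ∑ l with H i l = h, w l *
        ((π i h).elim 1 fun y =>
          (if D a (l (v x i)) then 1 else 0) * (if D a (l (v y i)) then 1 else 2)) := by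
      refine Finset.sum_congr rfl fun l hl => ?_
      simp only [g, (Finset.mem_filter.1 hl).2]
    rw [hcongr]
    cases hp : π i h with
    | none => simp only [Option.elim, mul_one]; nlinarith
    | some y =>
      have hq := (hπ i h y hp).2 a
      -- For rejection indicators r of `x` and r' of `y`: (1 - r)(1 + r') ≤ 1 - r + r'.
      have : ∀ l, w l * ((if D a (l (v x i)) then 1 else 0) * (if D a (l (v y i)) then 1 else 2))
          ≤ w l - w l * (if D a (l (v x i)) then 0 else 1)
            + w l * (if D a (l (v y i)) then 0 else 1) := by
        intro l
        have := hw l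
        split_ifs <;> linarith
      have h2 := Finset.sum_le_sum fun l (_ : l ∈ Finset.univ.filter fun l => H i l = h) => this l
      rw [Finset.sum_add_distrib, Finset.sum_sub_distrib] at h2
      simp only [Option.elim]
      change _ ≤ _ + _ at hq
      linarith
  have hprod : ∀ a, ∑ l, w l * ∏ i ∈ Finset.range d, g a i l ≤ (1 + ε) ^ d := fun a => by
    have := sum_mul_prod_le_pow_of_fiber_le w (g a) H (1 + ε) (by linarith) (hg a) (hdep a)
      (hle a) d
    rwa [hw1, mul_one] at this
  have hcard : (0 : ℝ) < Fintype.card L := by exact_mod_cast Fintype.card_pos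
  -- The label of `x` may depend on everything, so its term is bounded by the sum over all `a`. At
  -- `a = l x` the product is 2 to the number of rejections.
  have hB : ∑ l, w l * Real.exp (∑ i ∈ Finset.range d, F (l x) i l * Real.log 2) ≤
      Real.exp (Real.log (Fintype.card L) + d * ε) := by
    calc _ ≤ ∑ l, w l * ∑ a, ∏ i ∈ Finset.range d, g a i l := by
          refine Finset.sum_le_sum fun l _ => ?_
          by_cases hl : w l = 0
          · simp [hl]
          refine mul_le_mul_of_nonneg_left ?_ (hw l)
          refine le_trans (le_of_eq ?_) (Finset.single_le_sum
            (f := fun a => ∏ i ∈ Finset.range d, g a i l)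
            (fun a _ => Finset.prod_nonneg fun i _ => hg a i l) (Finset.mem_univ (l x)))
          rw [Real.exp_sum]
          refine Finset.prod_congr rfl fun i hi => ?_
          have hD := hacc l hl i (Finset.mem_range.1 hi)
          simp only [F, g]
          cases π i (H i l) with
          | none => simp
          | some y =>
            simp only [Option.elim, hD, if_true, one_mul]
            split_ifs <;> simp [Real.exp_log]
      _ = ∑ a, ∑ l, w l * ∏ i ∈ Finset.range d, g a i l := by
          simp only [Finset.mul_sum]
          exact Finset.sum_comm
      _ ≤ ∑ _a : L, (1 + ε) ^ d := Finset.sum_le_sum fun a _ => hprod a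
      _ = Fintype.card L * (1 + ε) ^ d := by simp
      _ ≤ Fintype.card L * Real.exp ε ^ d := by
          gcongr
          linarith [Real.add_one_le_exp ε]
      _ = _ := by rw [Real.exp_add, Real.exp_log hcard, Real.exp_nat_mul]
  have hJ := sum_mul_le_of_sum_mul_exp_le w hw hw1 _ _ hB
  rw [le_div_iff₀ hlog2, Finset.sum_comm, Finset.sum_mul]
  refine le_trans (le_of_eq (Finset.sum_congr rfl fun l _ => ?_)) hJ
  rw [← Finset.sum_mul, ← Finset.mul_sum, mul_assoc]

/-- There are a layer `i` and a rule that chooses, given the labels `h` of the first `i` layers,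
two centers such that the first one rarely rejects the `i`-th neighbour of the second one. -/
theorem exists_layer_and_rule (D : L → L → Bool) (w : (V → L) → ℝ) (hw : ∀ l, 0 ≤ w l)
    (hw1 : ∑ l, w l = 1) (C : Finset V) (v : V → ℕ → V) (d : ℕ) (hd : 0 < d)
    (hacc : ∀ l, w l ≠ 0 → ∀ x ∈ C, ∀ i < d, D (l x) (l (v x i)) = true)
    (m : ℕ) (hm : 0 < m) (hC : 2 * (m + 1) ^ Fintype.card L ≤ C.card) :
    ∃ i < d, ∃ f : (V → L) → V × V,
      (∀ h, (f h).1 ∈ C ∧ (f h).2 ∈ C ∧ (f h).1 ≠ (f h).2) ∧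
      ∑ l, w l * (if D (l (f (maskLabel (firstLayers C v i) l)).1)
        (l (v (f (maskLabel (firstLayers C v i) l)).2 i)) then 0 else 1) ≤
      2 * ((Real.log (Fintype.card L) / d + 1 / m) / Real.log 2) := by
  classical
  have hdR : (0 : ℝ) < d := by exact_mod_cast hd
  have hlog2 : 0 < Real.log 2 := Real.log_pos (by norm_num)
  set H : ℕ → (V → L) → (V → L) := fun i => maskLabel (firstLayers C v i) with hH
  -- Joint rather than conditional probabilities, which avoids dividing by the mass `p i h`.
  set q : ℕ → (V → L) → V → L → ℝ := fun i h x a =>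
    ∑ l with H i l = h, w l * (if D a (l (v x i)) then 0 else 1) with hq
  set p : ℕ → (V → L) → ℝ := fun i h => ∑ l with H i l = h, w l with hp
  have hq0 : ∀ i h x a, 0 ≤ q i h x a := fun i h x a =>
    Finset.sum_nonneg fun l _ => mul_nonneg (hw l) (by split_ifs <;> norm_num)
  have hqp : ∀ i h x a, q i h x a ≤ p i h := fun i h x a =>
    Finset.sum_le_sum fun l _ => by have := hw l; split_ifs <;> linarith
  let P : ℕ → (V → L) → V → Prop := fun i h x =>
    ∃ y ∈ C, y ≠ x ∧ ∀ a, q i h y a ≤ q i h x a + p i h / m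
  have hhalf : ∀ i h, C.card ≤ 2 * (C.filter (P i h)).card := fun i h =>
    card_le_two_mul_card_filter_exists_le_add C m hm (q i h) (p i h) (hq0 i h) (hqp i h) hC
  have hCpos : 0 < C.card := lt_of_lt_of_le (by positivity) hC
  let π : V → ℕ → (V → L) → Option V := fun x i h =>
    if hx : P i h x then some hx.choose else none
  have hπ : ∀ x i h y, π x i h = some y →
      y ∈ C ∧ y ≠ x ∧ ∀ a, q i h y a ≤ q i h x a + p i h / m := by
    intro x i h y hy
    by_cases hx : P i h x
    · simp only [π, hx, dif_pos, Option.some.injEq] at hy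
      exact hy ▸ hx.choose_spec
    · simp [π, hx] at hy
  let R : V → ℕ → (V → L) → ℝ := fun x i l =>
    (π x i (H i l)).elim 0 fun y => if D (l x) (l (v y i)) then 0 else 1
  have hR : ∀ x i l, 0 ≤ R x i l := by
    intro x i l
    simp only [R]
    cases π x i (H i l) with
    | none => simp
    | some y => simp only [Option.elim]; positivity
  have hx : ∀ x ∈ C, ∑ i ∈ Finset.range d, ∑ l, w l * R x i l ≤
      (Real.log (Fintype.card L) + d * (1 / m)) / Real.log 2 := by
    intro x hx
    refine sum_sum_rejected_partner_le D w hw hw1 C v d x hx (fun l hl => hacc l hl x hx) (1 / m)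
      (by positivity) (π x) fun i h y hy => ?_
    obtain ⟨h1, -, h3⟩ := hπ x i h y hy
    refine ⟨h1, fun a => (h3 a).trans (le_of_eq ?_)⟩
    simp only [hq, hp]; ring
  set B : ℝ := (Real.log (Fintype.card L) / d + 1 / m) / Real.log 2 with hB
  have hsum : ∑ i ∈ Finset.range d, ∑ x ∈ C, ∑ l, w l * R x i l ≤
      ∑ _i ∈ Finset.range d, C.card * B := by
    rw [Finset.sum_comm]
    refine (Finset.sum_le_sum hx).trans (le_of_eq ?_)
    simp only [Finset.sum_const, nsmul_eq_mul, Finset.card_range, hB]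
    field_simp
  obtain ⟨i, hi, hiB⟩ := Finset.exists_le_of_sum_le (Finset.nonempty_range_iff.2 hd.ne') hsum
  obtain ⟨X, hXmem, hX⟩ := exists_choice_sum_le (fun x l => w l * R x i l)
    (fun x l => mul_nonneg (hw l) (hR x i l)) (H i) C (Finset.card_pos.1 hCpos)
    (fun h => C.filter (P i h)) (fun h => Finset.filter_subset _ _) (hhalf i) B hiB
  have hXP : ∀ h, P i h (X h) := fun h => (Finset.mem_filter.1 (hXmem h)).2
  have hπX : ∀ h, π (X h) i h = some (hXP h).choose := fun h => dif_pos (hXP h)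
  refine ⟨i, Finset.mem_range.1 hi, fun h => (X h, (hXP h).choose), fun h =>
    ⟨(Finset.mem_filter.1 (hXmem h)).1, (hXP h).choose_spec.1, (hXP h).choose_spec.2.1.symm⟩, ?_⟩
  refine le_trans (le_of_eq (Finset.sum_congr rfl fun l _ => ?_)) hX
  simp only [R, hπX, Option.elim, hH]

end Partner

/-! ### Distances, neighbours and finite distributions -/

theorem SimpleGraph.not_adj_of_three_le_edist {V : Type*} {G : SimpleGraph V} {x y : V}
    (h : 3 ≤ G.edist x y) : ¬ G.Adj x y := by
  intro hxy
  have := SimpleGraph.edist_eq_one_iff_adj.2 hxy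
  rw [this] at h
  exact absurd h (by decide)

/-- Centers share no neighbour: this keeps the next layer unqueried and makes the declared pair a
non-edge. -/
theorem SimpleGraph.not_adj_and_adj_of_three_le_edist {V : Type*} {G : SimpleGraph V} {x y u : V}
    (h : 3 ≤ G.edist x y) (hx : G.Adj x u) : ¬ G.Adj y u := by
  intro hy
  have h1 := SimpleGraph.edist_eq_one_iff_adj.2 hx
  have h2 := SimpleGraph.edist_eq_one_iff_adj.2 hy.symm
  have := SimpleGraph.edist_triangle (G := G) (u := x) (v := u) (w := y)
  rw [h1, h2] at this
  exact absurd (h.trans this) (by decide)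

theorem exists_injOn_range_of_le_ncard {V : Type*} [Nonempty V] (s : Set V) (hs : s.Finite)
    (d : ℕ) (h : d ≤ s.ncard) :
    ∃ u : ℕ → V, (∀ i < d, u i ∈ s) ∧ Set.InjOn u (Set.Iio d) := by
  classical
  obtain ⟨t, hts, htc⟩ := Set.exists_subset_card_eq h
  have ht : t.Finite := hs.subset hts
  have hc : Nat.card t = d := by rw [← htc]; rfl
  have : Finite t := ht
  let e := (Finite.equivFinOfCardEq hc).symm
  refine ⟨fun i => if hi : i < d then e ⟨i, hi⟩ else Classical.arbitrary V, ?_, ?_⟩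
  · intro i hi
    simp only [hi, dif_pos]
    exact hts (e ⟨i, hi⟩).2
  · intro i hi j hj hij
    simp only [Set.mem_Iio] at hi hj
    simp only [hi, hj, dif_pos] at hij
    simpa using e.injective (Subtype.ext hij)

theorem PMF.toReal_toOuterMeasure_apply_fintype {Ω : Type*} [Fintype Ω] (μ : PMF Ω) (E : Set Ω)
    [DecidablePred (· ∈ E)] :
    (μ.toOuterMeasure E).toReal = ∑ ω, (μ ω).toReal * (if ω ∈ E then 1 else 0) := by
  classical
  rw [PMF.toOuterMeasure_apply_fintype, ENNReal.toReal_sum]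
  · refine Finset.sum_congr rfl fun ω _ => ?_
    by_cases h : ω ∈ E <;> simp [h]
  · intro ω _
    by_cases h : ω ∈ E <;> simp [h, PMF.apply_ne_top]

theorem PMF.sum_toReal_eq_one {Ω : Type*} [Fintype Ω] (μ : PMF Ω) :
    ∑ ω, (μ ω).toReal = 1 := by
  rw [← ENNReal.toReal_sum fun ω _ => PMF.apply_ne_top μ ω, ← tsum_fintype (L := .unconditional _),
    PMF.tsum_coe, ENNReal.toReal_one]

/-! ### The forging adversary -/

theorem mainTheorem2 (α : ℝ) (hα0 : 0 < α) (hα1 : α < 1) :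
    ∃ K : ℕ, ∀ (d s : ℕ), (s : ℝ) < α ^ 4 * (d : ℝ) / 34560 →
      ∀ (V : Type*) [Fintype V] (G : SimpleGraph V) (centers : Finset V),
        K ^ (2 ^ s) ≤ centers.card →
        (∀ x ∈ centers, d ≤ (G.neighborSet x).ncard) →
        (∀ x ∈ centers, ∀ y ∈ centers, x ≠ y → 3 ≤ G.edist x y) →
        ∀ S : AdjacencySketch V s, S.OneSided G →
          ∃ A : Adversary V (BitLabel s), A.IsLegal ∧ 1 - α ≤ S.forgeryProb G A := by
  -- Since log 2 > 1/2, this gives 2 / (m log 2) ≤ α/2; the other half of α pays for 2s/d. The extra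
  -- factor 2 in `K` supplies the 2 in `hC`.
  obtain ⟨m, hmα⟩ := exists_nat_gt (8 / α)
  have hmR : (0 : ℝ) < m := lt_trans (by positivity) hmα
  have hm : 0 < m := by exact_mod_cast hmR
  refine ⟨2 * (m + 1), fun d s hs V _ G C hK hdeg hdist S hS => ?_⟩
  classical
  have hd : 0 < d := by
    rcases Nat.eq_zero_or_pos d with rfl | h
    · have : (0 : ℝ) ≤ s := Nat.cast_nonneg s
      norm_num at hs
      linarith
    · exact h
  have hdR : (0 : ℝ) < d := by exact_mod_cast hd
  have hcardL : Fintype.card (BitLabel s) = 2 ^ s := by simp [BitLabel]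
  have hC : 2 * (m + 1) ^ Fintype.card (BitLabel s) ≤ C.card := by
    rw [hcardL]
    refine le_trans ?_ hK
    rw [mul_pow]
    exact Nat.mul_le_mul_right _ (Nat.le_self_pow (by positivity) 2)
  have hCne : C.Nonempty := Finset.card_pos.1 (lt_of_lt_of_le (by positivity) hC)
  have : Nonempty V := ⟨hCne.choose⟩
  have hnb : ∀ x, ∃ u : ℕ → V, x ∈ C →
      (∀ i < d, u i ∈ G.neighborSet x) ∧ Set.InjOn u (Set.Iio d) := by
    intro x
    by_cases hx : x ∈ C
    · obtain ⟨u, hu⟩ := exists_injOn_range_of_le_ncard _ (Set.toFinite _) d (hdeg x hx)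
      exact ⟨u, fun _ => hu⟩
    · exact ⟨fun _ => x, fun h => absurd h hx⟩
  choose v hv using hnb
  have hadj : ∀ x ∈ C, ∀ i < d, G.Adj x (v x i) := fun x hx i hi => (hv x hx).1 i hi
  have hacc : ∀ l, (S.encoder l).toReal ≠ 0 → ∀ x ∈ C, ∀ i < d,
      S.decode (l x) (l (v x i)) = true := by
    intro l hl x hx i hi
    have hl' : l ∈ S.encoder.support := by
      rw [PMF.mem_support_iff]
      intro h
      exact hl (by simp [h])
    have := hS l hl' x (v x i) (hadj x hx i hi)
    simp only [AdjacencySketch.Errs, not_not] at this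
    exact this.2 (hadj x hx i hi)
  obtain ⟨i, hi, f, hf, hbound⟩ := exists_layer_and_rule S.decode
    (fun l => (S.encoder l).toReal) (fun _ => ENNReal.toReal_nonneg)
    (PMF.sum_toReal_eq_one S.encoder) C v d hd hacc m hm hC
  have hvQ : ∀ y ∈ C, v y i ∉ firstLayers C v i := by
    intro y hy hmem
    obtain ⟨x, hx, j, hj, e⟩ := mem_firstLayers.1 hmem
    by_cases hxy : x = y
    · subst hxy
      exact hj.ne ((hv x hx).2 (hj.trans hi) hi e)
    · exact SimpleGraph.not_adj_and_adj_of_three_le_edist (hdist x hx y hy hxy)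
        (hadj x hx j (hj.trans hi)) (e ▸ hadj y hy i hi)
  have hcv : ∀ x ∈ C, ∀ y ∈ C, ∀ j < d, v y j ≠ x := by
    intro x hx y hy j hj e
    have hyx := e ▸ hadj y hy j hj
    exact SimpleGraph.not_adj_of_three_le_edist (hdist y hy x hx hyx.ne) hyx
  refine ⟨Adversary.queryAll (firstLayers C v i).toList (fun h => ((f h).1, v (f h).2 i))
    (fun _ => default), ?_, ?_⟩
  · refine Adversary.isLegalFrom_queryAll _ _ _ _ (Finset.nodup_toList _) (by simp) ?_ ?_ ?_
    · intro h
      exact (hcv _ (hf h).1 _ (hf h).2.1 i hi).symm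
    · intro h
      refine ⟨by simp, ?_⟩
      rw [Finset.mem_toList, mem_firstLayers]
      rintro ⟨y, hy, j, hj, e⟩
      exact hcv _ (hf h).1 y hy j (hj.trans hi) e
    · intro h
      refine ⟨by simp, ?_⟩
      rw [Finset.mem_toList]
      exact hvQ _ (hf h).2.1
  · rw [AdjacencySketch.forgeryProb, PMF.toReal_toOuterMeasure_apply_fintype]
    have hnadj : ∀ h, ¬ G.Adj (f h).1 (v (f h).2 i) := fun h =>
      SimpleGraph.not_adj_and_adj_of_three_le_edist
        (hdist _ (hf h).2.1 _ (hf h).1 (hf h).2.2.symm) (hadj _ (hf h).2.1 i hi)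
    have hcand : ∀ l, (Adversary.queryAll (firstLayers C v i).toList
        (fun h => ((f h).1, v (f h).2 i)) (fun _ => default)).candidates l =
        ((f (maskLabel (firstLayers C v i) l)).1, v (f (maskLabel (firstLayers C v i) l)).2 i) := by
      intro l
      rw [Adversary.candidates_queryAll]
      simp only [Finset.mem_toList]
      rfl
    have hrest : 2 * ((Real.log (Fintype.card (BitLabel s)) / d + 1 / m) / Real.log 2) ≤ α := by
      have hlog2 : 0 < Real.log 2 := Real.log_pos (by norm_num)
      have hlog2' : 1 / 2 < Real.log 2 := by linarith [Real.log_two_gt_d9]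
      have e : 2 * ((Real.log (Fintype.card (BitLabel s)) / d + 1 / m) / Real.log 2) =
          2 * (s / d) + 2 * (1 / m) / Real.log 2 := by
        rw [hcardL]
        push_cast
        rw [Real.log_pow]
        field_simp
      have h1 : (s : ℝ) / d ≤ α / 4 := by
        rw [div_le_iff₀ hdR]
        have hα4 : α ^ 4 ≤ α := by
          simpa using pow_le_pow_of_le_one hα0.le hα1.le (show 1 ≤ 4 by norm_num)
        have := mul_le_mul_of_nonneg_right hα4 hdR.le
        have := mul_pos hα0 hdR
        linarith
      have h2 : 1 / (m : ℝ) ≤ α / 8 := by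
        rw [div_lt_iff₀ hα0] at hmα
        rw [div_le_div_iff₀ hmR (by norm_num)]
        linarith
      have h3 : 2 * (1 / (m : ℝ)) / Real.log 2 ≤ α / 2 := by
        rw [div_le_iff₀ hlog2]
        nlinarith
      rw [e]; linarith
    have hb := hbound.trans hrest
    have htot := PMF.sum_toReal_eq_one S.encoder
    -- On a non-edge, forging and rejection are complementary.
    suffices h : ∑ l, (S.encoder l).toReal = ∑ l, (S.encoder l).toReal *
        (if S.decode (l (f (maskLabel (firstLayers C v i) l)).1)
          (l (v (f (maskLabel (firstLayers C v i) l)).2 i)) then 0 else 1) +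
        ∑ l, (S.encoder l).toReal * (if l ∈ {l | S.Errs G l
          ((Adversary.queryAll (firstLayers C v i).toList
            (fun h => ((f h).1, v (f h).2 i)) (fun _ => default)).candidates l).1
          ((Adversary.queryAll (firstLayers C v i).toList
            (fun h => ((f h).1, v (f h).2 i)) (fun _ => default)).candidates l).2}
          then 1 else 0) by
      linarith
    rw [← Finset.sum_add_distrib]
    refine Finset.sum_congr rfl fun l _ => ?_
    simp only [Set.mem_ofPred_eq, hcand, AdjacencySketch.Errs, hnadj, iff_false, not_not]
    split_ifs <;> simp
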